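/- Let $\mathcal Q$ be the set of qubit channels, i.e. completely positive trace-preserving linear maps on $M_2(\mathbb C)$. It is a compact convex set; its relative interior $\mathrm{ri}(\mathcal Q)$ is its interior in its affine hull, and $\partial\mathcal Q=\mathcal Q\setminus \mathrm{ri}(\mathcal Q)$. For $\mathcal F\in\mathcal Q$ define the boundariness $$b(\mathcal F)=1-\sup\,\max_j \pi_j ,$$ where the supremum is over all finite convex decompositions $\mathcal F=\sum_j\pi_j\mathcal E_j$ with all $\mathcal E_j\in\partial\mathcal Q$. Let $J_{\mathcal F}=(\mathcal F\otimes\mathcal I)[\Psi_+]$ with $\Psi_+=\tfrac12\sum_{j,k}|jj\rangle\langle kk|$ be the Choi–Jamiołkowski operator, let $|U\rangle\!\rangle=(U\otimes I)\sum_j|jj\rangle$, and let $\|\cdot\|_{\mathcal Q}$ be the base norm of $\mathcal Q$, $\|\Phi\|_{\mathcal Q}=\sup\{f(\Phi): f \text{ real linear},\ |f|\le 1\text{ on }\mathcal Q\}$ for $\Phi$ in the real linear span of $\mathcal Q$. Let $$W=\frac1{\sqrt2}\begin{pmatrix}0&0&1&i\\-1&i&0&0\\1&i&0&0\\0&0&1&-i\end{pmatrix}$$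 (the magic basis matrix, with rows ordered $|00\rangle,|01\rangle,|10\rangle,|11\rangle$), which is unitary. Theorem. Let $\mathcal F\in\mathrm{ri}(\mathcal Q)$. Then $J_{\mathcal F}$ is invertible, $R=W^\dagger J_{\mathcal F}^{-1}W+(W^\dagger J_{\mathcal F}^{-1}W)^T$ is a real symmetric matrix whose largest eigenvalue $\lambda_1(R)$ is positive, and $$b(\mathcal F)=\frac{2}{\lambda_1(R)} .$$ Moreover $\|\mathcal F-\mathcal E\|_{\mathcal Q}\le 2(1-b(\mathcal F))$ for every channel $\mathcal E\in\mathcal Q$. For every real unit eigenvector $v$ of $R$ for the eigenvalue $\lambda_1(R)$ there is a unitary $U$ with $|U\rangle\!\rangle=\sqrt2\,Wv$, and the unitary channel $\mathcal U:\rho\mapsto U\rho U^\dagger$ satisfies $\|\mathcal F-\mathcal U\|_{\mathcal Q}=2(1-b(\mathcal F))$. Conversely, if $U$ is a unitary whose channel $\mathcal U$ satisfies this equality, then $|U\rangle\!\rangle=c\sqrt2\,Wv$ for some $c\in\mathbb C$ with $|c|=1$ and some real unit eigenvector $v$ of $R$ for $\lambda_1(R)$. -/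

import Mathlib

open scoped Matrix ComplexOrder Kronecker

noncomputable section

namespace QuantumChannel

section ConvexSets

variable {V : Type*} [AddCommGroup V] [Module ℝ V] [TopologicalSpace V]

/-- The boundary `∂B = B \ ri(B)` of a compact convex set `B`, where `ri(B)` is the relative
interior, i.e. the interior of `B` in its affine hull. -/
def boundary (B : Set V) : Set V := B \ intrinsicInterior ℝ B

/-- `w` is the maximal weight of some finite convex decomposition `y = ∑ j, π j • x j`
into boundary points `x j ∈ ∂B`. -/
def IsMaxBoundaryWeight (B : Set V) (y : V) (w : ℝ) : Prop :=
  ∃ (m : ℕ) (π : Fin m → ℝ) (x : Fin m → V),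
    (∀ j, 0 ≤ π j) ∧ ∑ j, π j = 1 ∧ (∀ j, x j ∈ boundary B) ∧ ∑ j, π j • x j = y ∧
      IsGreatest (Set.range π) w

/-- The boundariness `b(y) = 1 - sup w`, the supremum running over the maximal weights `w` of all
convex decompositions of `y` into boundary points of `B`. -/
def boundariness (B : Set V) (y : V) : ℝ := 1 - sSup {w : ℝ | IsMaxBoundaryWeight B y w}

end ConvexSets

/-- The base norm of `v` with respect to a base `B`: the norm dual to the order unit norm,
`‖v‖_B = sup {⟨f, v⟩ : ‖f‖_e ≤ 1}`. Here `e` is the functional equal to `1` on `B`, so that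
`‖f‖_e ≤ 1` (that is, `e ± f` is positive on the cone generated by `B`) says `|f| ≤ 1` on `B`. -/
def baseNorm {V : Type*} [AddCommGroup V] [Module ℝ V] (B : Set V) (v : V) : ℝ :=
  sSup {r : ℝ | ∃ f : V →ₗ[ℝ] ℝ, (∀ z ∈ B, |f z| ≤ 1) ∧ f v = r}

/-- Linear maps on complex `n × n` matrices. They are all continuous, and the space
`→L[ℂ]` carries its (unique Hausdorff) vector space topology. -/
abbrev MatrixMap (n : Type*) [Fintype n] [DecidableEq n] : Type _ :=
  Matrix n n ℂ →L[ℂ] Matrix n n ℂ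

section Channels

variable {n : Type*} [Fintype n] [DecidableEq n]

/-- The map `Φ ⊗ id` applied to an operator `X` on `ℂⁿ ⊗ ℂᵏ`: `Φ` acts on every block of `X`. -/
def ampliation {k : Type*} (Φ : MatrixMap n) (X : Matrix (n × k) (n × k) ℂ) :
    Matrix (n × k) (n × k) ℂ :=
  Matrix.of fun p q => Φ (Matrix.of fun i j => X (i, p.2) (j, q.2)) p.1 q.1

/-- Complete positivity: every `Φ ⊗ id_k` preserves positive semidefiniteness. -/
def IsCompletelyPositive (Φ : MatrixMap n) : Prop :=
  ∀ (k : ℕ) (X : Matrix (n × Fin k) (n × Fin k) ℂ), X.PosSemidef → (ampliation Φ X).PosSemidef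

variable (n) in
/-- The set of quantum channels: completely positive trace-preserving maps. -/
def channels : Set (MatrixMap n) :=
  {Φ | IsCompletelyPositive Φ ∧ ∀ ρ : Matrix n n ℂ, (Φ ρ).trace = ρ.trace}

variable (n) in
/-- The unnormalized vector `∑ j, |jj⟩`. -/
def sumDiag : n × n → ℂ := fun p => if p.1 = p.2 then 1 else 0

variable (n) in
/-- The projection `Ψ₊ = (1/d) ∑ j k, |jj⟩⟨kk|`. -/
def psiPlus : Matrix (n × n) (n × n) ℂ :=
  ((Fintype.card n : ℂ)⁻¹) • Matrix.vecMulVec (sumDiag n) (star (sumDiag n))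

/-- The Choi–Jamiołkowski operator `J_Φ = (Φ ⊗ id)(Ψ₊)`. -/
def choi (Φ : MatrixMap n) : Matrix (n × n) (n × n) ℂ := ampliation Φ (psiPlus n)

/-- The vector `|U⟩⟩ = (U ⊗ I) ∑ j, |jj⟩`. -/
def vectorize (U : Matrix n n ℂ) : n × n → ℂ :=
  (U ⊗ₖ (1 : Matrix n n ℂ)) *ᵥ sumDiag n

/-- The map `ρ ↦ U ρ U†`. -/
def conjMap (U : Matrix n n ℂ) : MatrixMap n where
  toFun ρ := U * ρ * Uᴴ
  map_add' ρ σ := by rw [mul_add, add_mul]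
  map_smul' c ρ := by simp
  cont := by fun_prop

end Channels

/-- The magic basis matrix; its rows are indexed by the product basis of `ℂ² ⊗ ℂ²` in the order
`|00⟩, |01⟩, |10⟩, |11⟩`. -/
def magicW : Matrix (Fin 2 × Fin 2) (Fin 4) ℂ :=
  (((Real.sqrt 2 : ℝ) : ℂ)⁻¹) •
    (!![0, 0, 1, Complex.I;
        -1, Complex.I, 0, 0;
        1, Complex.I, 0, 0;
        0, 0, 1, -Complex.I] : Matrix (Fin 4) (Fin 4) ℂ).submatrix finProdFinEquiv id

/-- The set of (real) eigenvalues of a real square matrix. -/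
def realEigenvalues {m : Type*} [Fintype m] [DecidableEq m] (A : Matrix m m ℝ) : Set ℝ :=
  {μ | Module.End.HasEigenvalue (Matrix.toLin' A) μ}

/-- The largest eigenvalue `λ₁` of a real symmetric matrix. -/
def lambda1 {m : Type*} [Fintype m] [DecidableEq m] (A : Matrix m m ℝ) : ℝ :=
  sSup (realEigenvalues A)

/-- `v` is a leading unit eigenvector of `A`: a real unit vector with `A v = λ₁ v`. -/
def IsLeadingUnitEigenvector {m : Type*} [Fintype m] [DecidableEq m] (A : Matrix m m ℝ)
    (v : m → ℝ) : Prop :=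
  v ⬝ᵥ v = 1 ∧ A *ᵥ v = lambda1 A • v

/-- The vector `√2 W v` of `ℂ² ⊗ ℂ²`, for a real vector `v`. -/
def magicVector (v : Fin 4 → ℝ) : Fin 2 × Fin 2 → ℂ :=
  ((Real.sqrt 2 : ℝ) : ℂ) • (magicW *ᵥ fun i => ((v i : ℝ) : ℂ))

end QuantumChannel

end

open QuantumChannel

/-! Write `J` for the Choi operator of `F`, `l` for the largest eigenvalue of `R`, and `b = 2 / l`.
Everything rests on the operator inequality `J ≥ b • choi E` for every channel `E`
(`choi_sub_posSemidef`), which says that `E` can be split off from `F` with weight `b`. Test the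
inequality on `|A⟩⟩` with `A = U P` a polar decomposition. Cauchy–Schwarz for the Kraus operators of
`E` gives `⟨⟨A|J_E|A⟩⟩ ≤ ½ |⟨⟨U|A⟩⟩|²`, so unitary channels are the worst case. Cauchy–Schwarz in
the form `J` gives `|⟨⟨U|A⟩⟩|² ≤ ⟨⟨U|J⁻¹|U⟩⟩ ⟨⟨A|J|A⟩⟩`. Up to a phase, the qubit unitaries are
exactly the vectors `√2 W v` with `v` a real unit vector, and there `⟨⟨U|J⁻¹|U⟩⟩ = vᵀ R v ≤ l`. For
a leading eigenvector `v` the complement `G` in `F = b U + (1 - b) G` kills `J⁻¹|U⟩⟩`, so `G` lies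
on the boundary and `1 - b` is attained as a weight. No larger weight occurs
(`IsMaxBoundaryWeight.le`). Since `F - E = (1 - b)(G - E)`, the base norm is at most `2 (1 - b)`. A
functional built from `J⁻¹|U⟩⟩` separates `U` from `G` and gives equality. If `vᵀ R v < l`, more
than `b` of the unitary can be split off and the distance is strictly smaller. -/

noncomputable section

namespace QuantumChannel

open Topology

/-! ### Boundariness and base norm in a general convex set. -/

section ConvexSets

variable {V : Type*} [AddCommGroup V] [Module ℝ V]

theorem mem_intrinsicInterior_iff_nhdsWithin [TopologicalSpace V] {B : Set V} {y : V} :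
    y ∈ intrinsicInterior ℝ B ↔
      y ∈ affineSpan ℝ B ∧ B ∈ 𝓝[(affineSpan ℝ B : Set V)] y := by
  rw [mem_intrinsicInterior]
  constructor
  · rintro ⟨z, hz, rfl⟩
    exact ⟨z.2, preimage_coe_mem_nhds_subtype.1 (mem_interior_iff_mem_nhds.1 hz)⟩
  · rintro ⟨hy, h⟩
    exact ⟨⟨y, hy⟩, mem_interior_iff_mem_nhds.2 (preimage_coe_mem_nhds_subtype.2 h), rfl⟩

/-- From a point of the relative interior one can move a little away from any other point. -/
theorem exists_pos_extend_mem [TopologicalSpace V] [IsTopologicalAddGroup V]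
    [ContinuousSMul ℝ V] {B : Set V} {x y : V}
    (hy : y ∈ intrinsicInterior ℝ B) (hx : x ∈ B) : ∃ ε : ℝ, 0 < ε ∧ y + ε • (y - x) ∈ B := by
  obtain ⟨hyA, hB⟩ := mem_intrinsicInterior_iff_nhdsWithin.1 hy
  have hcont : Continuous fun ε : ℝ => y + ε • (y - x) := by fun_prop
  have hlim : Filter.Tendsto (fun ε : ℝ => y + ε • (y - x)) (𝓝 0)
      (𝓝[(affineSpan ℝ B : Set V)] y) := by
    refine tendsto_nhdsWithin_iff.2 ⟨?_, .of_forall fun ε => ?_⟩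
    · simpa using hcont.tendsto 0
    · have := (affineSpan ℝ B).smul_vsub_vadd_mem ε hyA (subset_affineSpan ℝ B hx) hyA
      simpa [add_comm] using this
  have hev := (hlim.eventually hB).filter_mono (nhdsWithin_le_nhds (s := Set.Ioi 0))
  obtain ⟨ε, h1, h2⟩ := (hev.and self_mem_nhdsWithin).exists
  exact ⟨ε, h2, h1⟩

/-- The contraction of ratio `t` towards `x` maps `B` into itself. Its inverse carries points of the
affine hull near the combination to points near `y`, which lie in `B`. -/
theorem combo_mem_intrinsicInterior [TopologicalSpace V] [IsTopologicalAddGroup V]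
    [ContinuousSMul ℝ V] {B : Set V} (hB : Convex ℝ B) {x y : V}
    (hy : y ∈ intrinsicInterior ℝ B) (hx : x ∈ B) {t : ℝ} (ht : 0 < t) (ht1 : t ≤ 1) :
    t • y + (1 - t) • x ∈ intrinsicInterior ℝ B := by
  obtain ⟨hyA, hBy⟩ := mem_intrinsicInterior_iff_nhdsWithin.1 hy
  have hyB : y ∈ B := mem_of_mem_nhdsWithin hyA hBy
  have hcombo : t • y + (1 - t) • x ∈ B := hB hyB hx ht.le (by linarith) (by ring)
  refine mem_intrinsicInterior_iff_nhdsWithin.2 ⟨subset_affineSpan ℝ B hcombo, ?_⟩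
  have hcont : Continuous fun z : V => x + t⁻¹ • (z - x) := by fun_prop
  have hlim : Filter.Tendsto (fun z : V => x + t⁻¹ • (z - x))
      (𝓝[(affineSpan ℝ B : Set V)] (t • y + (1 - t) • x))
      (𝓝[(affineSpan ℝ B : Set V)] y) := by
    refine tendsto_nhdsWithin_iff.2 ⟨?_, ?_⟩
    · have h := hcont.tendsto (t • y + (1 - t) • x)
      have h2 : x + t⁻¹ • (t • y + (1 - t) • x - x) = y := by
        have : t • y + (1 - t) • x - x = t • (y - x) := by module
        rw [this, inv_smul_smul₀ ht.ne']; abel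
      rw [h2] at h
      exact h.mono_left nhdsWithin_le_nhds
    · filter_upwards [self_mem_nhdsWithin] with z hz
      have hxA := subset_affineSpan ℝ B hx
      have := (affineSpan ℝ B).smul_vsub_vadd_mem t⁻¹ hz hxA hxA
      simpa [add_comm] using this
  filter_upwards [hlim.eventually hBy] with z hz
  have h := hB hz hx ht.le (by linarith) (show t + (1 - t) = 1 by ring)
  have h2 : t • (x + t⁻¹ • (z - x)) + (1 - t) • x = z := by
    rw [smul_add, smul_inv_smul₀ ht.ne']; module
  rwa [h2] at h

/-- Every term of a finite convex decomposition can be split off. -/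
theorem exists_eq_combo_of_sum {B : Set V} (hB : Convex ℝ B) {m : ℕ} {π : Fin m → ℝ}
    {x : Fin m → V} (h0 : ∀ j, 0 ≤ π j) (h1 : ∑ j, π j = 1) (hx : ∀ j, x j ∈ B) (j : Fin m) :
    ∃ h ∈ B, ∑ i, π i • x i = π j • x j + (1 - π j) • h := by
  have hs : π j + ∑ i ∈ Finset.univ.erase j, π i = 1 := by
    rw [Finset.add_sum_erase _ _ (Finset.mem_univ j), h1]
  rw [← Finset.add_sum_erase _ _ (Finset.mem_univ j)]
  have hn : ∀ i ∈ Finset.univ.erase j, 0 ≤ π i := fun i _ => h0 i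
  rcases (Finset.sum_nonneg hn).eq_or_lt' with h | h
  · refine ⟨x j, hx j, ?_⟩
    rw [Finset.sum_eq_zero fun i hi => by
      rw [(Finset.sum_eq_zero_iff_of_nonneg hn).1 h i hi, zero_smul]]
    simp [show π j = 1 by linarith]
  · refine ⟨(Finset.univ.erase j).centerMass π x, hB.centerMass_mem hn h fun i _ => hx i, ?_⟩
    rw [Finset.centerMass, show 1 - π j = ∑ i ∈ Finset.univ.erase j, π i by linarith,
      smul_inv_smul₀ h.ne']

/-- If every point of `B` has weight at least `b` in some decomposition of the relatively interior
point `y`, no boundary point has weight more than `1 - b`. -/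
theorem IsMaxBoundaryWeight.le [TopologicalSpace V] [IsTopologicalAddGroup V]
    [ContinuousSMul ℝ V] {B : Set V} (hB : Convex ℝ B) {y : V}
    (hy : y ∈ intrinsicInterior ℝ B) {b : ℝ} (hb : 0 < b) (hb1 : b ≤ 1)
    (hsplit : ∀ x ∈ B, ∃ g ∈ B, y = b • x + (1 - b) • g) {w : ℝ}
    (hw : IsMaxBoundaryWeight B y w) : w ≤ 1 - b := by
  obtain ⟨m, π, x, h0, h1, hx, rfl, ⟨j, rfl⟩, -⟩ := hw
  by_contra! hlt
  obtain ⟨h, hh, hsum⟩ := exists_eq_combo_of_sum hB h0 h1 (fun i => (hx i).1) j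
  rw [hsum] at hy hsplit
  obtain ⟨g, hg, hyg⟩ := hsplit h hh
  have hj1 : π j ≤ 1 := h1 ▸ Finset.single_le_sum (fun i _ => h0 i) (Finset.mem_univ j)
  have hj0 : 0 < π j := by linarith
  set w := π j
  -- Eliminating `h` between `F = w x + (1 - w) h` and `F = b h + (1 - b) g` writes `x` as a
  -- combination of `F` and `g`, with weight `(b - 1 + w) / (b w)` on `F`. This is positive as `w >
  -- 1 - b`, so `x` would be relatively interior.
  have hbw : 0 < b * w := mul_pos hb hj0
  have ht : 0 < (b - 1 + w) / (b * w) := div_pos (by linarith) hbw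
  have ht1 : (b - 1 + w) / (b * w) ≤ 1 := by
    rw [div_le_one hbw]; nlinarith
  refine (hx j).2 ?_
  convert combo_mem_intrinsicInterior hB hy hg ht ht1 using 1
  have key : (b * w) • x j = (b - 1 + w) • (w • x j + (1 - w) • h)
      + (b * w - (b - 1 + w)) • g := by
    have e1 : (b * w) • x j = b • (w • x j + (1 - w) • h)
      - (1 - w) • (w • x j + (1 - w) • h) + (1 - w) • (w • x j + (1 - w) • h)
      - (1 - w) • (b • h) := by module
    have e2 : b • h = (w • x j + (1 - w) • h) - (1 - b) • g := by rw [hyg]; module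
    rw [e1, e2]; module
  have e3 : 1 - (b - 1 + w) / (b * w) = (b * w)⁻¹ * (b * w - (b - 1 + w)) := by
    field_simp
  rw [e3, div_eq_inv_mul, mul_smul, mul_smul, ← smul_add, ← key, inv_smul_smul₀ hbw.ne']

theorem boundariness_eq_of_split [TopologicalSpace V] [IsTopologicalAddGroup V]
    [ContinuousSMul ℝ V] {B : Set V} (hB : Convex ℝ B) {y : V}
    (hy : y ∈ intrinsicInterior ℝ B) {b : ℝ} (hb : 0 < b) (hb1 : b ≤ 1)
    (hsplit : ∀ x ∈ B, ∃ g ∈ B, y = b • x + (1 - b) • g) {u g : V} (hu : u ∈ boundary B)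
    (hg : g ∈ boundary B) (hug : y = b • u + (1 - b) • g) : boundariness B y = b := by
  have hle : ∀ w, IsMaxBoundaryWeight B y w → w ≤ 1 - b :=
    fun w hw => hw.le hB hy hb hb1 hsplit
  have hmem : IsMaxBoundaryWeight B y (max b (1 - b)) := by
    refine ⟨2, ![b, 1 - b], ![u, g], ?_, by simp, ?_, by simp [hug], ?_, ?_⟩
    · simp [Fin.forall_fin_two, hb.le, hb1]
    · simp [Fin.forall_fin_two, hu, hg]
    · rcases max_choice b (1 - b) with h | h <;> rw [h]
      · exact ⟨0, rfl⟩
      · exact ⟨1, rfl⟩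
    · rintro _ ⟨i, rfl⟩
      fin_cases i <;> simp
  -- The upper bound, applied to this very decomposition, rules out `b > 1 - b`.
  have hmax : max b (1 - b) = 1 - b := le_antisymm (hle _ hmem) (le_max_right _ _)
  rw [hmax] at hmem
  have : sSup {w : ℝ | IsMaxBoundaryWeight B y w} = 1 - b :=
    IsGreatest.csSup_eq ⟨hmem, hle⟩
  rw [boundariness, this]; ring

theorem le_of_mem_unit_dual {B : Set V} {x g y : V} (hx : x ∈ B) (hg : g ∈ B) {b : ℝ}
    (hb1 : b ≤ 1) (h : y = b • x + (1 - b) • g) {f : V →ₗ[ℝ] ℝ} (hf : ∀ z ∈ B, |f z| ≤ 1) :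
    f (y - x) ≤ 2 * (1 - b) := by
  have e : y - x = (1 - b) • (g - x) := by rw [h]; module
  rw [e, map_smul, map_sub, smul_eq_mul]
  have h1 := (abs_le.1 (hf x hx)).1
  have h2 := (abs_le.1 (hf g hg)).2
  nlinarith

theorem baseNorm_sub_le {B : Set V} {x g y : V} (hx : x ∈ B) (hg : g ∈ B) {b : ℝ}
    (hb1 : b ≤ 1) (h : y = b • x + (1 - b) • g) : baseNorm B (y - x) ≤ 2 * (1 - b) := by
  refine Real.sSup_le ?_ (by linarith)
  rintro _ ⟨f, hf, rfl⟩
  exact le_of_mem_unit_dual hx hg hb1 h hf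

/-- The bound on the base norm distance is attained if a functional separates `x` and `g`
perfectly. -/
theorem baseNorm_sub_eq {B : Set V} {x g y : V} (hx : x ∈ B) (hg : g ∈ B) {b : ℝ}
    (hb1 : b ≤ 1) (h : y = b • x + (1 - b) • g) {f : V →ₗ[ℝ] ℝ} (hf : ∀ z ∈ B, |f z| ≤ 1)
    (hfx : f x = -1) (hfg : f g = 1) : baseNorm B (y - x) = 2 * (1 - b) := by
  refine le_antisymm (baseNorm_sub_le hx hg hb1 h) (le_csSup ⟨2 * (1 - b), ?_⟩ ⟨f, hf, ?_⟩)
  · rintro _ ⟨f, hf, rfl⟩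
    exact le_of_mem_unit_dual hx hg hb1 h hf
  · rw [show y - x = (1 - b) • (g - x) by rw [h]; module, map_smul, map_sub, hfx, hfg, smul_eq_mul]
    ring

end ConvexSets

/-! ### The Choi correspondence. -/

section Choi

variable {n : Type*} [Fintype n] [DecidableEq n]

theorem choi_apply (Φ : MatrixMap n) (p q : n × n) :
    choi Φ p q = (Fintype.card n : ℂ)⁻¹ * Φ (Matrix.single p.2 q.2 1) p.1 q.1 := by
  have h : (Matrix.of fun i j => psiPlus n (i, p.2) (j, q.2)) =
      (Fintype.card n : ℂ)⁻¹ • Matrix.single p.2 q.2 (1 : ℂ) := by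
    ext i j
    simp only [psiPlus, sumDiag, Matrix.of_apply, Matrix.smul_apply, Matrix.vecMulVec_apply,
      Matrix.single_apply, Pi.star_apply, smul_eq_mul]
    by_cases h1 : i = p.2 <;> by_cases h2 : j = q.2 <;> simp [h1, h2, eq_comm]
  rw [choi, ampliation, Matrix.of_apply, h, map_smul, Matrix.smul_apply, smul_eq_mul]

theorem ampliation_add {k : Type*} (Φ Ψ : MatrixMap n) (X : Matrix (n × k) (n × k) ℂ) :
    ampliation (Φ + Ψ) X = ampliation Φ X + ampliation Ψ X := rfl

theorem ampliation_smul {k : Type*} (r : ℝ) (Φ : MatrixMap n) (X : Matrix (n × k) (n × k) ℂ) :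
    ampliation (r • Φ) X = r • ampliation Φ X := rfl

theorem choi_add (Φ Ψ : MatrixMap n) : choi (Φ + Ψ) = choi Φ + choi Ψ := rfl

theorem choi_sub (Φ Ψ : MatrixMap n) : choi (Φ - Ψ) = choi Φ - choi Ψ := rfl

theorem choi_smul (r : ℝ) (Φ : MatrixMap n) : choi (r • Φ) = r • choi Φ := rfl

theorem posSemidef_psiPlus : (psiPlus n).PosSemidef :=
  (Matrix.posSemidef_vecMulVec_self_star _).smul (by positivity)

theorem IsCompletelyPositive.choi_posSemidef {d : ℕ} {Φ : MatrixMap (Fin d)}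
    (h : IsCompletelyPositive Φ) : (choi Φ).PosSemidef :=
  h d _ posSemidef_psiPlus

theorem apply_eq_sum_choi [Nonempty n] (Φ : MatrixMap n) (ρ : Matrix n n ℂ) (i j : n) :
    Φ ρ i j = (Fintype.card n : ℂ) * ∑ k, ∑ l, ρ k l * choi Φ (i, k) (j, l) := by
  have hc : (Fintype.card n : ℂ) ≠ 0 := by exact_mod_cast Fintype.card_ne_zero
  conv_lhs => rw [Matrix.matrix_eq_sum_single ρ]
  simp only [map_sum, Matrix.sum_apply, Finset.mul_sum, choi_apply]
  refine Finset.sum_congr rfl fun k _ => Finset.sum_congr rfl fun l _ => ?_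
  rw [show Matrix.single k l (ρ k l) = ρ k l • Matrix.single k l (1 : ℂ) by
    rw [Matrix.smul_single, smul_eq_mul, mul_one], map_smul, Matrix.smul_apply, smul_eq_mul]
  field_simp

/-- A map with positive semidefinite Choi operator is completely positive. -/
theorem IsCompletelyPositive.of_choi [Nonempty n] {Φ : MatrixMap n} (h : (choi Φ).PosSemidef) :
    IsCompletelyPositive Φ := by
  intro d X hX
  obtain ⟨m, v, hv⟩ := Matrix.posSemidef_iff_eq_sum_vecMulVec.1 h
  -- A vector of the rank-one decomposition, reshaped to a matrix, is a Kraus operator up to scale;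
  -- `C` is that operator tensored with the identity.
  let C : Fin m → Matrix (n × Fin d) (n × Fin d) ℂ := fun m =>
    Matrix.of fun p q => if p.2 = q.2 then v m (p.1, q.1) else 0
  have hsum : ampliation Φ X = (Fintype.card n : ℂ) • ∑ m, C m * X * (C m)ᴴ := by
    ext ⟨i, p⟩ ⟨j, q⟩
    rw [ampliation, Matrix.of_apply, apply_eq_sum_choi, hv]
    simp only [Matrix.smul_apply, Matrix.sum_apply, smul_eq_mul, Matrix.mul_apply,
      Matrix.conjTranspose_apply, Matrix.of_apply, C, Fintype.sum_prod_type, ite_mul, zero_mul,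
      Finset.sum_ite_eq, Finset.mem_univ, if_true, apply_ite star, star_zero, mul_ite,
      mul_zero, Matrix.vecMulVec_apply, Pi.star_apply, Finset.mul_sum, Finset.sum_mul]
    rw [Finset.sum_comm]
    conv_rhs => rw [Finset.sum_comm]
    refine Finset.sum_congr rfl fun l _ => ?_
    rw [Finset.sum_comm]
    refine Finset.sum_congr rfl fun a _ => Finset.sum_congr rfl fun k _ => ?_
    ring
  rw [hsum]
  exact (Matrix.posSemidef_sum _ fun m _ => hX.mul_mul_conjTranspose_same _).smul (by positivity)

/-- Trace preservation fixes the partial trace over the output factor. This is the scalar marginal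
required by the polar decomposition bound. -/
theorem sum_choi_of_tracePreserving {Φ : MatrixMap n}
    (h : ∀ ρ : Matrix n n ℂ, (Φ ρ).trace = ρ.trace) (k l : n) :
    ∑ i, choi Φ (i, k) (i, l) = if k = l then (Fintype.card n : ℂ)⁻¹ else 0 := by
  have := h (Matrix.single k l 1)
  simp only [choi_apply, ← Finset.mul_sum]
  rw [Matrix.trace] at this
  simp only [Matrix.diag_apply] at this
  rw [this]
  split_ifs with hkl
  · subst hkl; simp
  · rw [Matrix.trace_single_eq_of_ne _ _ _ hkl, mul_zero]

theorem trace_choi_of_tracePreserving [Nonempty n] {Φ : MatrixMap n}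
    (h : ∀ ρ : Matrix n n ℂ, (Φ ρ).trace = ρ.trace) : (choi Φ).trace = 1 := by
  have hc : (Fintype.card n : ℂ) ≠ 0 := by exact_mod_cast Fintype.card_ne_zero
  rw [Matrix.trace, Fintype.sum_prod_type, Finset.sum_comm]
  simp [sum_choi_of_tracePreserving h, hc]

theorem vectorize_apply (U : Matrix n n ℂ) (p : n × n) : vectorize U p = U p.1 p.2 := by
  simp [vectorize, Matrix.mulVec, dotProduct, sumDiag, Fintype.sum_prod_type, Matrix.one_apply,
    Matrix.kroneckerMap_apply]

theorem vectorize_injective : Function.Injective (vectorize : Matrix n n ℂ → n × n → ℂ) := by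
  intro U V h
  ext i j
  simpa [vectorize_apply] using congrFun h (i, j)

theorem choi_conjMap (U : Matrix n n ℂ) : choi (conjMap U) =
    (Fintype.card n : ℂ)⁻¹ • Matrix.vecMulVec (vectorize U) (star (vectorize U)) := by
  ext p q
  rw [choi_apply]
  simp [conjMap, Matrix.vecMulVec_apply, vectorize_apply, Matrix.mul_apply, Matrix.single_apply,
    ite_and]

theorem conjMap_mem_channels {U : Matrix n n ℂ} [Nonempty n] (hU : U ∈ Matrix.unitaryGroup n ℂ) :
    conjMap U ∈ channels n := by
  refine ⟨.of_choi ?_, fun ρ => ?_⟩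
  · rw [choi_conjMap]
    exact (Matrix.posSemidef_vecMulVec_self_star _).smul (by positivity)
  · change (U * ρ * Uᴴ).trace = _
    rw [Matrix.trace_mul_cycle, ← Matrix.star_eq_conjTranspose, Matrix.mem_unitaryGroup_iff'.1 hU,
      one_mul]

theorem convex_channels : Convex ℝ (channels n) := by
  intro Φ hΦ Ψ hΨ a b ha hb hab
  refine ⟨fun k X hX => ?_, fun ρ => ?_⟩
  · rw [ampliation_add, ampliation_smul, ampliation_smul]
    exact ((hΦ.1 k X hX).smul ha).add ((hΨ.1 k X hX).smul hb)
  · change (a • Φ ρ + b • Ψ ρ).trace = _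
    rw [Matrix.trace_add, Matrix.trace_smul, Matrix.trace_smul, hΦ.2, hΨ.2, ← add_smul, hab,
      one_smul]

/-- Order between Choi operators becomes a convex decomposition: the remainder has trace factor `1 -
t`, and dividing by it restores trace preservation. -/
theorem exists_channel_of_sub_posSemidef [Nonempty n] {Φ Ψ : MatrixMap n} (hΦ : Φ ∈ channels n)
    (hΨ : Ψ ∈ channels n) {t : ℝ} (ht : t < 1)
    (h : (choi Φ - t • choi Ψ).PosSemidef) :
    (1 - t)⁻¹ • (Φ - t • Ψ) ∈ channels n ∧
      Φ = t • Ψ + (1 - t) • ((1 - t)⁻¹ • (Φ - t • Ψ)) := by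
  have h1 : 0 < 1 - t := by linarith
  refine ⟨⟨.of_choi ?_, fun ρ => ?_⟩, ?_⟩
  · rw [choi_smul, choi_sub, choi_smul]
    exact h.smul (inv_nonneg.2 h1.le)
  · change ((1 - t)⁻¹ • (Φ ρ - t • Ψ ρ)).trace = _
    rw [Matrix.trace_smul, Matrix.trace_sub, Matrix.trace_smul, hΦ.2, hΨ.2]
    rw [show ρ.trace - t • ρ.trace = (1 - t) • ρ.trace by module, inv_smul_smul₀ h1.ne']
  · rw [smul_inv_smul₀ h1.ne']; abel

end Choi

/-! ### The magic basis: real unit vectors as elements of SU(2). -/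

section MagicBasis

theorem magicW_apply (i j : Fin 2) (k : Fin 4) : magicW (i, j) k =
    ((Real.sqrt 2 : ℝ) : ℂ)⁻¹ * (!![![0, 0, 1, Complex.I], ![-1, Complex.I, 0, 0];
      ![1, Complex.I, 0, 0], ![0, 0, 1, -Complex.I]] :
      Matrix (Fin 2) (Fin 2) (Fin 4 → ℂ)) i j k := by
  fin_cases i <;> fin_cases j <;> rfl

theorem ofReal_sqrt_two_mul_self : ((Real.sqrt 2 : ℝ) : ℂ) * ((Real.sqrt 2 : ℝ) : ℂ) = 2 := by
  rw [← Complex.ofReal_mul, Real.mul_self_sqrt (by norm_num)]; norm_num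

theorem ofReal_sqrt_two_ne_zero : ((Real.sqrt 2 : ℝ) : ℂ) ≠ 0 := by
  intro h
  simpa [h] using ofReal_sqrt_two_mul_self

theorem inv_sqrt_two_mul_self :
    ((Real.sqrt 2 : ℝ) : ℂ)⁻¹ * ((Real.sqrt 2 : ℝ) : ℂ)⁻¹ = 2⁻¹ := by
  rw [← mul_inv, ofReal_sqrt_two_mul_self]

theorem conjTranspose_magicW_mul_self : magicWᴴ * magicW = 1 := by
  have h := inv_sqrt_two_mul_self
  ext k l
  simp only [Matrix.mul_apply, Fintype.sum_prod_type, Matrix.conjTranspose_apply, magicW_apply,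
    Fin.sum_univ_two]
  have hr : star ((Real.sqrt 2 : ℝ) : ℂ)⁻¹ = ((Real.sqrt 2 : ℝ) : ℂ)⁻¹ := by simp
  simp only [star_mul', hr]
  generalize ((Real.sqrt 2 : ℝ) : ℂ)⁻¹ = c at *
  have hI := Complex.I_mul_I
  fin_cases k <;> fin_cases l <;> simp <;>
    first | linear_combination 2 * h | linear_combination 2 * h - 2 * c * c * hI

theorem magicW_mul_conjTranspose_self : magicW * magicWᴴ = 1 := by
  exact (Matrix.mul_eq_one_comm_of_equiv finProdFinEquiv.symm).1 conjTranspose_magicW_mul_self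

/-- The unitary `U` with `|U⟩⟩ = √2 W v`. -/
def magicUnitary (v : Fin 4 → ℝ) : Matrix (Fin 2) (Fin 2) ℂ :=
  !![(v 2 : ℂ) + v 3 * Complex.I, -(v 0 : ℂ) + v 1 * Complex.I;
    (v 0 : ℂ) + v 1 * Complex.I, (v 2 : ℂ) - v 3 * Complex.I]

theorem vectorize_magicUnitary (v : Fin 4 → ℝ) :
    vectorize (magicUnitary v) = magicVector v := by
  ext ⟨i, j⟩
  rw [vectorize_apply, magicVector, Pi.smul_apply, Matrix.mulVec, dotProduct]
  simp only [magicW_apply, mul_assoc, ← Finset.mul_sum, smul_eq_mul]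
  rw [mul_inv_cancel_left₀ ofReal_sqrt_two_ne_zero]
  fin_cases i <;> fin_cases j <;> simp [magicUnitary, Fin.sum_univ_four] <;> ring

theorem magicUnitary_mem {v : Fin 4 → ℝ} (hv : v ⬝ᵥ v = 1) :
    magicUnitary v ∈ Matrix.unitaryGroup (Fin 2) ℂ := by
  have hv' : v 0 * v 0 + v 1 * v 1 + v 2 * v 2 + v 3 * v 3 = 1 := by
    simpa [dotProduct, Fin.sum_univ_four] using hv
  rw [Matrix.mem_unitaryGroup_iff, Matrix.star_eq_conjTranspose]
  ext i j
  fin_cases i <;> fin_cases j <;>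
    simp [magicUnitary, Matrix.mul_apply, Complex.ext_iff] <;> constructor <;> linarith

/-- Dividing `U` by a square root `c` of its determinant lands in SU(2), whose elements are
determined by their first column `(a, b)`. The real and imaginary parts of `b` and `a` are the
coordinates of `v`. -/
theorem exists_magicVector_of_unitary {U : Matrix (Fin 2) (Fin 2) ℂ}
    (hU : U ∈ Matrix.unitaryGroup (Fin 2) ℂ) :
    ∃ (c : ℂ) (v : Fin 4 → ℝ), ‖c‖ = 1 ∧ v ⬝ᵥ v = 1 ∧ vectorize U = c • magicVector v := by
  have h1 : U * Uᴴ = 1 := Matrix.mem_unitaryGroup_iff.1 hU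
  have h2 : Uᴴ * U = 1 := Matrix.mem_unitaryGroup_iff'.1 hU
  obtain ⟨c, hc⟩ := IsAlgClosed.exists_pow_nat_eq U.det two_pos
  have hdet : U.det * star U.det = 1 := by
    rw [← Matrix.det_conjTranspose, ← Matrix.det_mul, h1, Matrix.det_one]
  have hcn : ‖c‖ = 1 := by
    have := congrArg norm hdet
    rw [norm_mul, norm_star, ← hc, norm_pow, norm_one] at this
    have h0 := norm_nonneg c
    nlinarith [sq_nonneg (‖c‖ ^ 2 - 1), sq_nonneg (‖c‖ - 1)]
  have hcc : c * star c = 1 := by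
    rw [Complex.star_def, Complex.mul_conj, Complex.normSq_eq_norm_sq, hcn]; norm_num
  -- Comparing the explicit adjugate with `det U • Uᴴ` expresses the second column through the
  -- first.
  have hadj : U.adjugate = U.det • Uᴴ := by
    calc U.adjugate = U.adjugate * (U * Uᴴ) := by rw [h1, mul_one]
      _ = U.det • Uᴴ := by rw [← mul_assoc, Matrix.adjugate_mul, Matrix.smul_mul, one_mul]
  rw [Matrix.adjugate_fin_two] at hadj
  have e1 : U 1 1 = c ^ 2 * star (U 0 0) := by simpa [hc] using congrFun₂ hadj 0 0
  have e2 : -U 0 1 = c ^ 2 * star (U 1 0) := by simpa [hc] using congrFun₂ hadj 0 1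
  have e3 : star (U 0 0) * U 0 0 + star (U 1 0) * U 1 0 = 1 := by
    simpa [Matrix.mul_apply] using congrFun₂ h2 0 0
  obtain ⟨a, ha⟩ : ∃ a, a = star c * U 0 0 := ⟨_, rfl⟩
  obtain ⟨b, hb⟩ : ∃ b, b = star c * U 1 0 := ⟨_, rfl⟩
  have ea : U 0 0 = c * a := by rw [ha, ← mul_assoc, hcc, one_mul]
  have eb : U 1 0 = c * b := by rw [hb, ← mul_assoc, hcc, one_mul]
  have ed : U 1 1 = c * star a := by rw [e1, ha, star_mul', star_star]; ring
  have ec : U 0 1 = c * -star b := by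
    rw [← neg_neg (U 0 1), e2, hb, star_mul', star_star]; ring
  refine ⟨c, ![b.re, b.im, a.re, a.im], hcn, ?_, ?_⟩
  · rw [ea, eb, star_mul' c a, star_mul' c b] at e3
    have e4 : star a * a + star b * b = 1 := by
      linear_combination e3 - (star a * a + star b * b) * hcc
    have := congrArg Complex.re e4
    simp [dotProduct, Fin.sum_univ_four] at this ⊢
    linarith
  · rw [← vectorize_magicUnitary]
    ext ⟨i, j⟩
    simp only [vectorize_apply, Pi.smul_apply, smul_eq_mul]
    fin_cases i <;> fin_cases j <;> simp [ea, eb, ec, ed, magicUnitary, Complex.ext_iff]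
    constructor <;> ring

end MagicBasis

/-! ### Variational characterization of the largest eigenvalue. -/

section LargestEigenvalue

variable {m : Type*} [Fintype m] [DecidableEq m] {A : Matrix m m ℝ}

theorem realEigenvalues_eq_spectrum (A : Matrix m m ℝ) : realEigenvalues A = spectrum ℝ A := by
  ext μ
  rw [realEigenvalues, Set.mem_ofPred_eq, Module.End.hasEigenvalue_iff_mem_spectrum,
    Matrix.spectrum_toLin']

theorem isGreatest_lambda1 [Nonempty m] (hA : A.IsHermitian) :
    IsGreatest (realEigenvalues A) (lambda1 A) := by
  have h : realEigenvalues A = Set.range hA.eigenvalues := by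
    rw [realEigenvalues_eq_spectrum, hA.spectrum_real_eq_range_eigenvalues]
  have hfin : (realEigenvalues A).Finite := h ▸ Set.finite_range _
  have hne : (realEigenvalues A).Nonempty := h ▸ Set.range_nonempty _
  exact ⟨hne.csSup_mem hfin, fun μ hμ => le_csSup hfin.bddAbove hμ⟩

theorem posSemidef_lambda1_sub [Nonempty m] (hA : A.IsHermitian) :
    (lambda1 A • (1 : Matrix m m ℝ) - A).PosSemidef := by
  rw [Matrix.posSemidef_iff_isHermitian_and_spectrum_nonneg]
  refine ⟨(Matrix.isHermitian_one.smul (IsSelfAdjoint.all _)).sub hA, ?_⟩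
  rw [← Algebra.algebraMap_eq_smul_one, ← spectrum.singleton_sub_eq]
  rintro _ ⟨_, rfl, μ, hμ, rfl⟩
  rw [← realEigenvalues_eq_spectrum] at hμ
  exact sub_nonneg.2 ((isGreatest_lambda1 hA).2 hμ)

theorem dotProduct_mulVec_le_lambda1 [Nonempty m] (hA : A.IsHermitian) {v : m → ℝ}
    (hv : v ⬝ᵥ v = 1) : v ⬝ᵥ A *ᵥ v ≤ lambda1 A := by
  have := (posSemidef_lambda1_sub hA).dotProduct_mulVec_nonneg v
  simpa [Matrix.sub_mulVec, Matrix.smul_mulVec, hv] using this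

/-- The equality case of the Rayleigh bound: a vector on which a positive semidefinite form vanishes
lies in its kernel. -/
theorem isLeadingUnitEigenvector_of_le [Nonempty m] (hA : A.IsHermitian) {v : m → ℝ}
    (hv : v ⬝ᵥ v = 1) (h : lambda1 A ≤ v ⬝ᵥ A *ᵥ v) : IsLeadingUnitEigenvector A v := by
  have h2 := le_antisymm (dotProduct_mulVec_le_lambda1 hA hv) h
  have := ((posSemidef_lambda1_sub hA).dotProduct_mulVec_zero_iff v).1
    (by simp [Matrix.sub_mulVec, Matrix.smul_mulVec, hv, h2])
  refine ⟨hv, ?_⟩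
  rw [Matrix.sub_mulVec, Matrix.smul_mulVec, Matrix.one_mulVec, sub_eq_zero] at this
  exact this.symm

theorem exists_isLeadingUnitEigenvector [Nonempty m] (hA : A.IsHermitian) :
    ∃ v, IsLeadingUnitEigenvector A v := by
  obtain ⟨v, hv⟩ := (isGreatest_lambda1 hA).1.exists_hasEigenvector
  have hv0 : 0 < v ⬝ᵥ v := by
    have := Matrix.dotProduct_star_self_pos_iff.2 hv.2
    simpa using this
  have hs := Real.mul_self_sqrt hv0.le
  have hs0 := (Real.sqrt_pos.2 hv0).ne'
  refine ⟨(Real.sqrt (v ⬝ᵥ v))⁻¹ • v, ?_, ?_⟩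
  · rw [smul_dotProduct, dotProduct_smul, smul_eq_mul, smul_eq_mul]
    rw [← mul_assoc, ← mul_inv, hs, inv_mul_cancel₀ hv0.ne']
  · rw [Matrix.mulVec_smul, smul_comm]
    congr 1
    simpa using hv.apply_eq_smul

end LargestEigenvalue

/-! ### Cauchy–Schwarz inequalities for positive matrices. -/

section QuadraticForms

variable {n : Type*} [Fintype n]

theorem norm_sq_dotProduct_le (x y : n → ℂ) :
    ‖star x ⬝ᵥ y‖ ^ 2 ≤ (star x ⬝ᵥ x).re * (star y ⬝ᵥ y).re := by
  have h := norm_inner_le_norm (𝕜 := ℂ) (WithLp.toLp 2 x) (WithLp.toLp 2 y)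
  have e (x : n → ℂ) : (star x ⬝ᵥ x).re = ‖WithLp.toLp 2 x‖ ^ 2 := by
    rw [EuclideanSpace.norm_sq_eq, dotProduct, Complex.re_sum]
    refine Finset.sum_congr rfl fun i _ => ?_
    simp [← Complex.normSq_eq_norm_sq, Complex.normSq_apply]
  rw [e, e, ← mul_pow, dotProduct_comm]
  exact pow_le_pow_left₀ (norm_nonneg _)
    (by simpa [EuclideanSpace.inner_eq_star_dotProduct] using h) 2

theorem norm_sq_dotProduct_mulVec_le {J : Matrix n n ℂ} (hJ : J.PosSemidef) (x y : n → ℂ) :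
    ‖star x ⬝ᵥ J *ᵥ y‖ ^ 2 ≤ (star x ⬝ᵥ J *ᵥ x).re * (star y ⬝ᵥ J *ᵥ y).re := by
  classical
  open scoped MatrixOrder in
  obtain ⟨B, hB⟩ := CStarAlgebra.nonneg_iff_eq_star_mul_self.mp hJ.nonneg
  rw [Matrix.star_eq_conjTranspose] at hB
  have e (x y : n → ℂ) : star x ⬝ᵥ J *ᵥ y = star (B *ᵥ x) ⬝ᵥ (B *ᵥ y) := by
    rw [hB, ← Matrix.mulVec_mulVec, Matrix.dotProduct_mulVec, Matrix.star_mulVec]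
  rw [e, e, e]
  exact norm_sq_dotProduct_le _ _

theorem _root_.Matrix.PosDef.star_inv_mulVec_dotProduct [DecidableEq n] {J : Matrix n n ℂ}
    (hJ : J.PosDef) (x y : n → ℂ) : star (J⁻¹ *ᵥ x) ⬝ᵥ J *ᵥ y = star x ⬝ᵥ y := by
  have hdet : IsUnit J.det := (Matrix.isUnit_iff_isUnit_det _).1 hJ.isUnit
  rw [Matrix.star_mulVec, hJ.inv.1.eq, ← Matrix.dotProduct_mulVec, Matrix.mulVec_mulVec,
    Matrix.nonsing_inv_mul _ hdet, Matrix.one_mulVec]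

/-- Cauchy–Schwarz in the form `J`, applied to `J⁻¹ x` and `y`. -/
theorem _root_.Matrix.PosDef.norm_sq_dotProduct_le_inv [DecidableEq n] {J : Matrix n n ℂ}
    (hJ : J.PosDef) (x y : n → ℂ) :
    ‖star x ⬝ᵥ y‖ ^ 2 ≤ (star x ⬝ᵥ J⁻¹ *ᵥ x).re * (star y ⬝ᵥ J *ᵥ y).re := by
  have h := norm_sq_dotProduct_mulVec_le hJ.posSemidef (J⁻¹ *ᵥ x) y
  rwa [hJ.star_inv_mulVec_dotProduct, hJ.star_inv_mulVec_dotProduct] at h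

theorem posSemidef_of_re {J : Matrix n n ℂ} (hJ : J.IsHermitian)
    (h : ∀ x, 0 ≤ (star x ⬝ᵥ J *ᵥ x).re) : J.PosSemidef := by
  refine .of_dotProduct_mulVec_nonneg hJ fun x => Complex.nonneg_iff.2 ⟨h x, ?_⟩
  exact (hJ.im_star_dotProduct_mulVec_self x).symm

theorem dotProduct_vecMulVec_mulVec (u x y : n → ℂ) :
    star x ⬝ᵥ Matrix.vecMulVec u (star u) *ᵥ y = (star x ⬝ᵥ u) * (star u ⬝ᵥ y) := by
  rw [Matrix.vecMulVec_mulVec, dotProduct_smul]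
  simp [mul_comm]

theorem star_dotProduct_comm (x y : n → ℂ) : star x ⬝ᵥ y = star (star y ⬝ᵥ x) := by
  rw [Matrix.star_dotProduct]

theorem re_dotProduct_vecMulVec (u x : n → ℂ) :
    (star x ⬝ᵥ Matrix.vecMulVec u (star u) *ᵥ x).re = ‖star u ⬝ᵥ x‖ ^ 2 := by
  rw [dotProduct_vecMulVec_mulVec, star_dotProduct_comm x u, ← Complex.normSq_eq_norm_sq]
  simp [Complex.normSq_apply]

end QuadraticForms

/-! ### Polar decomposition and domination of all operators with scalar marginal. -/

section PolarDecomposition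

variable {n : Type*} [Fintype n] [DecidableEq n]

theorem exists_polar_decomposition {A : Matrix n n ℂ} (hA : A.det ≠ 0) :
    ∃ U ∈ Matrix.unitaryGroup n ℂ, ∃ P : Matrix n n ℂ, P.PosSemidef ∧ A = U * P := by
  open scoped MatrixOrder in
  have hS : 0 ≤ Aᴴ * A := (Matrix.posSemidef_conjTranspose_mul_self A).nonneg
  open scoped MatrixOrder in
  obtain ⟨P, hP, hPP⟩ :
      ∃ P : Matrix n n ℂ, P.PosSemidef ∧ P * P = Aᴴ * A :=
    ⟨CFC.sqrt (Aᴴ * A), Matrix.nonneg_iff_posSemidef.1 (CFC.sqrt_nonneg _), CFC.sqrt_mul_sqrt_self _ hS⟩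
  have hdet : IsUnit P.det := by
    rw [isUnit_iff_ne_zero]
    intro h0
    have := congrArg Matrix.det hPP
    simp [h0, hA] at this
  refine ⟨A * P⁻¹, ?_, P, hP, by rw [mul_assoc, Matrix.nonsing_inv_mul _ hdet, mul_one]⟩
  rw [Matrix.mem_unitaryGroup_iff', Matrix.star_eq_conjTranspose, Matrix.conjTranspose_mul,
    Matrix.conjTranspose_nonsing_inv, hP.1.eq, mul_assoc, ← mul_assoc Aᴴ, ← hPP, mul_assoc P,
    Matrix.mul_nonsing_inv _ hdet, mul_one, Matrix.nonsing_inv_mul _ hdet]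

theorem star_vectorize_dotProduct (A K : Matrix n n ℂ) :
    star (vectorize A) ⬝ᵥ vectorize K = (Aᴴ * K).trace := by
  rw [dotProduct, Fintype.sum_prod_type, Finset.sum_comm]
  simp [Matrix.trace, Matrix.mul_apply, vectorize_apply]

theorem exists_vectorize_eq (x : n × n → ℂ) : ∃ A : Matrix n n ℂ, vectorize A = x :=
  ⟨Matrix.of fun i j => x (i, j), by ext ⟨i, j⟩; simp [vectorize_apply]⟩

/-- With `P = Bᴴ B`, this is Hilbert–Schmidt Cauchy–Schwarz for `Bᴴ` and `K Bᴴ`. -/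
theorem norm_sq_trace_mul_le {P : Matrix n n ℂ} (hP : P.PosSemidef) (K : Matrix n n ℂ) :
    ‖(P * K).trace‖ ^ 2 ≤ P.trace.re * (Kᴴ * K * P).trace.re := by
  open scoped MatrixOrder in
  obtain ⟨B, hB⟩ := CStarAlgebra.nonneg_iff_eq_star_mul_self.mp hP.nonneg
  rw [Matrix.star_eq_conjTranspose] at hB
  have h := norm_sq_dotProduct_le (vectorize Bᴴ) (vectorize (K * Bᴴ))
  simp only [star_vectorize_dotProduct, Matrix.conjTranspose_conjTranspose,
    Matrix.conjTranspose_mul] at h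
  have e1 : (P * K).trace = (B * (K * Bᴴ)).trace := by
    rw [hB, mul_assoc, Matrix.trace_mul_comm Bᴴ, mul_assoc]
  have e2 : P.trace = (B * Bᴴ).trace := by rw [hB, Matrix.trace_mul_comm]
  have e3 : (Kᴴ * K * P).trace = (B * Kᴴ * (K * Bᴴ)).trace := by
    rw [hB, ← mul_assoc, Matrix.trace_mul_comm _ B]
    simp only [mul_assoc]
  rwa [e1, e2, e3]

/-- Among the operators with a fixed scalar marginal, the overlap with `|A⟩⟩` is maximized by the
unitary of the polar decomposition of `A`. -/
theorem re_dotProduct_mulVec_vectorize_le {A U P : Matrix n n ℂ}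
    (hU : U ∈ Matrix.unitaryGroup n ℂ) (hP : P.PosSemidef) (hA : A = U * P)
    {J : Matrix (n × n) (n × n) ℂ} (hJ : J.PosSemidef) {c : ℝ}
    (hc : ∀ k l, ∑ i, J (i, k) (i, l) = if k = l then (c : ℂ) else 0) :
    (star (vectorize A) ⬝ᵥ J *ᵥ vectorize A).re ≤
      c * ‖star (vectorize U) ⬝ᵥ vectorize A‖ ^ 2 := by
  have hUU : Uᴴ * U = 1 := Matrix.mem_unitaryGroup_iff'.1 hU
  have hUU' : U * Uᴴ = 1 := Matrix.mem_unitaryGroup_iff.1 hU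
  obtain ⟨m, v, hv⟩ := Matrix.posSemidef_iff_eq_sum_vecMulVec.1 hJ
  choose K hK using fun i => exists_vectorize_eq (v i)
  -- The scalar marginal is the Kraus normalization. The indices are exchanged because the marginal
  -- of `J` is the transpose of `∑ Kᴴ K`.
  have hsum : ∑ i, (K i)ᴴ * K i = (c : ℂ) • 1 := by
    ext k l
    have h := hc l k
    simp only [hv, Matrix.sum_apply, Matrix.vecMulVec_apply, Pi.star_apply, ← hK,
      vectorize_apply] at h
    rw [Finset.sum_comm] at h
    simp only [Matrix.sum_apply, Matrix.mul_apply, Matrix.conjTranspose_apply, Matrix.smul_apply,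
      Matrix.one_apply, smul_eq_mul, mul_ite, mul_one, mul_zero, mul_comm (star _), h, eq_comm]
  have hterm (i : Fin m) : ‖star (v i) ⬝ᵥ vectorize A‖ ^ 2 ≤
      P.trace.re * ((K i)ᴴ * K i * P).trace.re := by
    have h := norm_sq_trace_mul_le hP (Uᴴ * K i)
    rw [star_dotProduct_comm, norm_star, ← hK, star_vectorize_dotProduct, hA,
      Matrix.conjTranspose_mul, hP.1.eq, mul_assoc]
    rwa [Matrix.conjTranspose_mul, Matrix.conjTranspose_conjTranspose, mul_assoc (K i)ᴴ,
      ← mul_assoc U, hUU', one_mul] at h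
  -- Here `⟨⟨U|A⟩⟩ = tr P` is real, so the bounds in `hterm` sum exactly to `c (tr P)²`.
  have hnorm : ‖P.trace‖ ^ 2 = P.trace.re * P.trace.re := by
    obtain ⟨-, him⟩ := Complex.nonneg_iff.1 hP.trace_nonneg
    rw [← Complex.normSq_eq_norm_sq, Complex.normSq_apply, ← him]; ring
  rw [star_vectorize_dotProduct, hA, ← mul_assoc, hUU, one_mul, hnorm, ← hA]
  calc (star (vectorize A) ⬝ᵥ J *ᵥ vectorize A).re
      = ∑ i, ‖star (v i) ⬝ᵥ vectorize A‖ ^ 2 := by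
        rw [hv, Matrix.sum_mulVec, dotProduct_sum, Complex.re_sum]
        exact Finset.sum_congr rfl fun i _ => re_dotProduct_vecMulVec _ _
    _ ≤ ∑ i, P.trace.re * ((K i)ᴴ * K i * P).trace.re := Finset.sum_le_sum fun i _ => hterm i
    _ = c * (P.trace.re * P.trace.re) := by
        rw [← Finset.mul_sum, ← Complex.re_sum, ← Matrix.trace_sum, ← Finset.sum_mul, hsum,
          Matrix.smul_mul, one_mul, Matrix.trace_smul, smul_eq_mul, Complex.re_ofReal_mul]
        ring

open Topology in
-- As a function of `t` the determinant is the characteristic polynomial of `-A`, which has finitely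
-- many roots.
theorem eventually_det_add_smul_one_ne_zero (A : Matrix n n ℂ) :
    ∀ᶠ t : ℂ in 𝓝[≠] 0, (A + t • (1 : Matrix n n ℂ)).det ≠ 0 := by
  have hfin : {t : ℂ | (-A).charpoly.IsRoot t}.Finite :=
    Polynomial.finite_setOfPred_isRoot (Matrix.charpoly_monic _).ne_zero
  refine nhdsNE_le_cofinite _ (Filter.mem_of_superset hfin.compl_mem_cofinite fun t ht h => ht ?_)
  change (-A).charpoly.eval t = 0
  rw [Matrix.eval_charpoly, sub_neg_eq_add, add_comm, ← h, Matrix.smul_one_eq_diagonal]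
  rfl

open Topology in
/-- A positive definite `J` whose inverse is at most `L` on all vectorized unitaries dominates
every operator with scalar marginal. -/
theorem posSemidef_smul_sub {J E : Matrix (n × n) (n × n) ℂ} (hJ : J.PosDef)
    (hE : E.PosSemidef) {c L : ℝ} (hc0 : 0 ≤ c)
    (hc : ∀ k l, ∑ i, E (i, k) (i, l) = if k = l then (c : ℂ) else 0)
    (hL : ∀ U ∈ Matrix.unitaryGroup n ℂ,
      (star (vectorize U) ⬝ᵥ J⁻¹ *ᵥ vectorize U).re ≤ L) :
    ((c * L) • J - E).PosSemidef := by
  refine posSemidef_of_re ((hJ.1.smul (IsSelfAdjoint.all _)).sub hE.1) fun x => ?_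
  obtain ⟨A, rfl⟩ := exists_vectorize_eq x
  -- The polar decomposition used here needs an invertible `A`; a singular one is reached as the
  -- limit of `A + t • 1`.
  have key (A : Matrix n n ℂ) (hA : A.det ≠ 0) :
      0 ≤ (star (vectorize A) ⬝ᵥ ((c * L) • J - E) *ᵥ vectorize A).re := by
    obtain ⟨U, hU, P, hP, hAU⟩ := exists_polar_decomposition hA
    have h1 := re_dotProduct_mulVec_vectorize_le hU hP hAU hE hc
    have h2 := hJ.norm_sq_dotProduct_le_inv (vectorize U) (vectorize A)
    have h5 := mul_le_mul_of_nonneg_right (hL U hU)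
      (hJ.posSemidef.re_dotProduct_nonneg (vectorize A))
    simp only [RCLike.re_to_complex] at h5
    have h6 := mul_le_mul_of_nonneg_left (h2.trans h5) hc0
    rw [Matrix.sub_mulVec, Matrix.smul_mulVec, dotProduct_sub, dotProduct_smul, Complex.sub_re,
      Complex.smul_re, smul_eq_mul]
    linarith
  have hcont : Continuous fun t : ℂ =>
      (star (vectorize (A + t • 1)) ⬝ᵥ ((c * L) • J - E) *ᵥ vectorize (A + t • 1)).re := by
    have h (t : ℂ) : vectorize (A + t • 1) = vectorize A + t • vectorize (1 : Matrix n n ℂ) := by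
      ext p; simp [vectorize_apply]
    simp only [h]
    fun_prop
  have hlim := (hcont.tendsto 0).mono_left (nhdsWithin_le_nhds (s := {0}ᶜ))
  simp only [zero_smul, add_zero] at hlim
  exact ge_of_tendsto hlim ((eventually_det_add_smul_one_ne_zero A).mono fun t ht => key _ ht)

end PolarDecomposition

/-! ### Interior and boundary qubit channels, and the matrix `R`. -/

section QubitChannels

instance continuousSMul_real_matrixMap {n : Type*} [Fintype n] [DecidableEq n] :
    ContinuousSMul ℝ (MatrixMap n) :=
  ⟨show Continuous fun p : ℝ × MatrixMap n => (p.1 : ℂ) • p.2 from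
    (Complex.continuous_ofReal.comp continuous_fst).smul continuous_snd⟩

theorem magicVector_ne_zero {v : Fin 4 → ℝ} (hv : v ⬝ᵥ v = 1) : magicVector v ≠ 0 := by
  intro h
  have h1 := Matrix.mem_unitaryGroup_iff.1 (magicUnitary_mem hv)
  have h2 : magicUnitary v = 0 := vectorize_injective (by
    rw [vectorize_magicUnitary, h]; ext p; simp [vectorize_apply])
  rw [h2, zero_mul] at h1
  exact zero_ne_one h1

theorem choi_conjMap_mulVec (U : Matrix (Fin 2) (Fin 2) ℂ) (x : Fin 2 × Fin 2 → ℂ) :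
    choi (conjMap U) *ᵥ x = ((2 : ℂ)⁻¹ * (star (vectorize U) ⬝ᵥ x)) • vectorize U := by
  rw [choi_conjMap, Matrix.smul_mulVec, Matrix.vecMulVec_mulVec, mul_smul]
  simp

theorem re_dotProduct_choi_conjMap (U : Matrix (Fin 2) (Fin 2) ℂ) (x : Fin 2 × Fin 2 → ℂ) :
    (star x ⬝ᵥ choi (conjMap U) *ᵥ x).re = 2⁻¹ * ‖star (vectorize U) ⬝ᵥ x‖ ^ 2 := by
  rw [← re_dotProduct_vecMulVec, choi_conjMap, Matrix.smul_mulVec, dotProduct_smul]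
  simp

/-- The Choi operator of a relatively interior channel is positive definite. -/
theorem choi_posDef {F : MatrixMap (Fin 2)}
    (hF : F ∈ intrinsicInterior ℝ (channels (Fin 2))) : (choi F).PosDef := by
  have hJ : (choi F).PosSemidef := (intrinsicInterior_subset hF).1.choi_posSemidef
  refine .of_dotProduct_mulVec_pos hJ.1 fun x hx =>
    (hJ.dotProduct_mulVec_nonneg x).lt_of_ne' fun h0 => hx ?_
  -- Moving from `F` slightly away from a unitary channel keeps a channel. On `x`, where the form of
  -- `J_F` vanishes, its form is `-(ε/2) |⟨⟨U|x⟩⟩|²`, so the overlap is zero.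
  have horth (v : Fin 4 → ℝ) (hv : v ⬝ᵥ v = 1) : star (magicVector v) ⬝ᵥ x = 0 := by
    obtain ⟨ε, hε, hG⟩ := exists_pos_extend_mem hF (conjMap_mem_channels (magicUnitary_mem hv))
    have h := hG.1.choi_posSemidef.re_dotProduct_nonneg x
    rw [choi_add, choi_smul, choi_sub, Matrix.add_mulVec, Matrix.smul_mulVec, Matrix.sub_mulVec,
      dotProduct_add, dotProduct_smul, dotProduct_sub, h0, RCLike.re_to_complex, zero_add, zero_sub,
      Complex.smul_re, Complex.neg_re, re_dotProduct_choi_conjMap, vectorize_magicUnitary,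
      smul_eq_mul] at h
    have h1 : ‖star (magicVector v) ⬝ᵥ x‖ ^ 2 ≤ 0 := by
      by_contra! h1
      nlinarith [mul_pos hε h1]
    exact norm_eq_zero.1 (pow_eq_zero_iff two_ne_zero |>.1 (le_antisymm h1 (by positivity)))
  -- The coordinate vectors `v` already yield a basis of the whole space.
  have hW : magicWᴴ *ᵥ x = 0 := by
    ext k
    have h := horth (Pi.single k 1) (by simp)
    have e : (fun i => ((Pi.single k (1 : ℝ) : Fin 4 → ℝ) i : ℂ)) = Pi.single k 1 := by
      ext i; by_cases hi : i = k <;> simp [hi]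
    rw [magicVector, e, Matrix.mulVec_single_one, star_smul, smul_dotProduct, smul_eq_mul] at h
    exact (mul_eq_zero.1 h).resolve_left (star_ne_zero.2 ofReal_sqrt_two_ne_zero)
  rw [← Matrix.one_mulVec x, ← magicW_mul_conjTranspose_self, ← Matrix.mulVec_mulVec, hW,
    Matrix.mulVec_zero]

theorem mem_boundary_of_choi_mulVec_eq_zero {E : MatrixMap (Fin 2)} (hE : E ∈ channels (Fin 2))
    {x : Fin 2 × Fin 2 → ℂ} (hx : x ≠ 0) (h : choi E *ᵥ x = 0) :
    E ∈ boundary (channels (Fin 2)) :=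
  ⟨hE, fun hri => by simpa [h] using (choi_posDef hri).dotProduct_mulVec_pos hx⟩

/-- The Choi operator has rank one, and `U Z` with `Z = diag(1, -1)` is orthogonal to `U` because
`Z` is traceless. -/
theorem exists_choi_conjMap_mulVec_eq_zero {U : Matrix (Fin 2) (Fin 2) ℂ}
    (hU : U ∈ Matrix.unitaryGroup (Fin 2) ℂ) : ∃ x ≠ 0, choi (conjMap U) *ᵥ x = 0 := by
  have hUU : Uᴴ * U = 1 := Matrix.mem_unitaryGroup_iff'.1 hU
  refine ⟨vectorize (U * !![1, 0; 0, -1]), fun h0 => ?_, ?_⟩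
  · have h1 : U * !![1, 0; 0, -1] = 0 :=
      vectorize_injective (by rw [h0]; ext p; simp [vectorize_apply])
    have h2 : Uᴴ * (U * !![1, 0; 0, -1]) = 0 := by rw [h1, mul_zero]
    rw [← mul_assoc, hUU, one_mul] at h2
    simpa using congrFun₂ h2 0 0
  · rw [choi_conjMap_mulVec, star_vectorize_dotProduct, ← mul_assoc, hUU, one_mul]
    simp [Matrix.trace_fin_two]

theorem conjMap_mem_boundary {U : Matrix (Fin 2) (Fin 2) ℂ}
    (hU : U ∈ Matrix.unitaryGroup (Fin 2) ℂ) : conjMap U ∈ boundary (channels (Fin 2)) :=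
  let ⟨_, hx, h⟩ := exists_choi_conjMap_mulVec_eq_zero hU
  mem_boundary_of_choi_mulVec_eq_zero (conjMap_mem_channels hU) hx h

/-- The real symmetric matrix `W† K W + (W† K W)ᵀ`. -/
def magicSymm (K : Matrix (Fin 2 × Fin 2) (Fin 2 × Fin 2) ℂ) : Matrix (Fin 4) (Fin 4) ℝ :=
  (magicWᴴ * K * magicW + (magicWᴴ * K * magicW)ᵀ).map Complex.re

variable {K : Matrix (Fin 2 × Fin 2) (Fin 2 × Fin 2) ℂ}

/-- The transpose of a Hermitian matrix is its entrywise conjugate, so the sum is real and taking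
real parts loses nothing. -/
theorem magicSymm_map (hK : K.IsHermitian) : (magicSymm K).map (fun r : ℝ => (r : ℂ)) =
    magicWᴴ * K * magicW + (magicWᴴ * K * magicW)ᵀ := by
  have h := Matrix.isHermitian_conjTranspose_mul_mul magicW hK
  ext i j
  have hij := h.apply i j
  simp only [magicSymm, Matrix.map_apply, Matrix.add_apply, Matrix.transpose_apply, ← hij]
  simp [Complex.ext_iff]

theorem isSymm_magicSymm : (magicSymm K).IsSymm := by
  ext i j
  simp only [magicSymm, Matrix.transpose_apply, Matrix.map_apply, Matrix.add_apply]
  rw [add_comm]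

theorem isHermitian_magicSymm : (magicSymm K).IsHermitian := by
  rw [Matrix.IsHermitian, Matrix.conjTranspose_eq_transpose_of_trivial]
  exact isSymm_magicSymm

/-- For real `v` a matrix and its transpose have the same quadratic form. The two summands of `R`
thus account for the factor 2 from `√2` squared. -/
theorem dotProduct_magicVector (hK : K.IsHermitian) (v : Fin 4 → ℝ) :
    star (magicVector v) ⬝ᵥ K *ᵥ magicVector v = ((v ⬝ᵥ magicSymm K *ᵥ v : ℝ) : ℂ) := by
  have e : ((v ⬝ᵥ magicSymm K *ᵥ v : ℝ) : ℂ) = (fun i => (v i : ℂ)) ⬝ᵥ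
      (magicSymm K).map (fun r : ℝ => (r : ℂ)) *ᵥ fun i => (v i : ℂ) := by
    simp [dotProduct, Matrix.mulVec]
  have hs : star (fun i => (v i : ℂ)) = fun i => (v i : ℂ) := by ext i; simp
  have ht (N : Matrix (Fin 4) (Fin 4) ℂ) (w : Fin 4 → ℂ) : w ⬝ᵥ Nᵀ *ᵥ w = w ⬝ᵥ N *ᵥ w := by
    rw [Matrix.mulVec_transpose, dotProduct_comm, Matrix.dotProduct_mulVec]
  rw [e, magicSymm_map hK, Matrix.add_mulVec, dotProduct_add, ht, ← two_mul, magicVector,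
    star_smul, Matrix.star_mulVec, hs, Matrix.mulVec_smul, smul_dotProduct, dotProduct_smul,
    ← Matrix.dotProduct_mulVec, Matrix.mulVec_mulVec, Matrix.mulVec_mulVec]
  simp only [smul_eq_mul, ← mul_assoc]
  congr 1
  simpa using ofReal_sqrt_two_mul_self

theorem exists_dotProduct_vectorize (hK : K.IsHermitian) {U : Matrix (Fin 2) (Fin 2) ℂ}
    (hU : U ∈ Matrix.unitaryGroup (Fin 2) ℂ) : ∃ (c : ℂ) (v : Fin 4 → ℝ), ‖c‖ = 1 ∧
      v ⬝ᵥ v = 1 ∧ vectorize U = c • magicVector v ∧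
      star (vectorize U) ⬝ᵥ K *ᵥ vectorize U = ((v ⬝ᵥ magicSymm K *ᵥ v : ℝ) : ℂ) := by
  obtain ⟨c, v, hc, hv, h⟩ := exists_magicVector_of_unitary hU
  refine ⟨c, v, hc, hv, h, ?_⟩
  rw [h, star_smul, Matrix.mulVec_smul, smul_dotProduct, dotProduct_smul,
    dotProduct_magicVector hK, smul_smul, Complex.star_def, ← Complex.normSq_eq_conj_mul_self,
    Complex.normSq_eq_norm_sq, hc]
  simp

theorem re_dotProduct_vectorize_le (hK : K.IsHermitian) {U : Matrix (Fin 2) (Fin 2) ℂ}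
    (hU : U ∈ Matrix.unitaryGroup (Fin 2) ℂ) :
    (star (vectorize U) ⬝ᵥ K *ᵥ vectorize U).re ≤ lambda1 (magicSymm K) := by
  obtain ⟨c, v, -, hv, -, h⟩ := exists_dotProduct_vectorize hK hU
  rw [h, Complex.ofReal_re]
  exact dotProduct_mulVec_le_lambda1 isHermitian_magicSymm hv

theorem IsLeadingUnitEigenvector.dotProduct_magicVector (hK : K.IsHermitian) {v : Fin 4 → ℝ}
    (hv : IsLeadingUnitEigenvector (magicSymm K) v) :
    star (magicVector v) ⬝ᵥ K *ᵥ magicVector v = (lambda1 (magicSymm K) : ℂ) := by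
  rw [QuantumChannel.dotProduct_magicVector hK, hv.2, dotProduct_smul, hv.1, smul_eq_mul, mul_one]

theorem lambda1_magicSymm_pos (hK : K.PosDef) : 0 < lambda1 (magicSymm K) := by
  obtain ⟨v, hv⟩ := exists_isLeadingUnitEigenvector (isHermitian_magicSymm (K := K))
  have h := hK.dotProduct_mulVec_pos (magicVector_ne_zero hv.1)
  rw [hv.dotProduct_magicVector hK.1] at h
  exact_mod_cast h

end QubitChannels

/-! ### Optimal splitting, boundariness and base norm. -/

section Main

variable {F : MatrixMap (Fin 2)}

theorem choi_sub_posSemidef (hF : F ∈ intrinsicInterior ℝ (channels (Fin 2)))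
    {E : MatrixMap (Fin 2)} (hE : E ∈ channels (Fin 2)) :
    (choi F - (2 / lambda1 (magicSymm (choi F)⁻¹)) • choi E).PosSemidef := by
  have hJ := choi_posDef hF
  have hl := lambda1_magicSymm_pos hJ.inv
  have h := posSemidef_smul_sub hJ hE.1.choi_posSemidef (c := 2⁻¹) (by norm_num)
    (fun k l => by simpa using sum_choi_of_tracePreserving hE.2 k l)
    fun U hU => re_dotProduct_vectorize_le hJ.inv.1 hU
  have h2 := h.smul (div_pos two_pos hl).le
  rwa [smul_sub, smul_smul, show 2 / lambda1 (magicSymm (choi F)⁻¹) *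
    (2⁻¹ * lambda1 (magicSymm (choi F)⁻¹)) = 1 by field_simp, one_smul] at h2

theorem choi_ne_of_unitary (hF : F ∈ intrinsicInterior ℝ (channels (Fin 2)))
    {U : Matrix (Fin 2) (Fin 2) ℂ} (hU : U ∈ Matrix.unitaryGroup (Fin 2) ℂ) :
    choi F ≠ choi (conjMap U) := by
  intro h
  obtain ⟨x, hx, h0⟩ := exists_choi_conjMap_mulVec_eq_zero hU
  simpa [h, h0] using (choi_posDef hF).dotProduct_mulVec_pos hx

/-- Traces give `≤`. Equality would make a positive semidefinite difference traceless, hence zero,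
although `J_F` is nonsingular and a unitary channel has a singular Choi operator. -/
theorem two_div_lambda1_lt_one (hF : F ∈ intrinsicInterior ℝ (channels (Fin 2))) :
    2 / lambda1 (magicSymm (choi F)⁻¹) < 1 := by
  have hU : (1 : Matrix (Fin 2) (Fin 2) ℂ) ∈ Matrix.unitaryGroup (Fin 2) ℂ := one_mem _
  have hE := conjMap_mem_channels hU
  have h := choi_sub_posSemidef hF hE
  have htr := h.trace_nonneg
  rw [Matrix.trace_sub, Matrix.trace_smul,
    trace_choi_of_tracePreserving (intrinsicInterior_subset hF).2,
    trace_choi_of_tracePreserving hE.2] at htr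
  have hle : 2 / lambda1 (magicSymm (choi F)⁻¹) ≤ 1 := by
    have := (Complex.nonneg_iff.1 htr).1
    simpa using this
  refine hle.lt_of_ne fun h1 => choi_ne_of_unitary hF hU ?_
  rw [h1, one_smul] at h
  refine sub_eq_zero.1 (h.trace_eq_zero_iff.1 ?_)
  rw [Matrix.trace_sub, trace_choi_of_tracePreserving (intrinsicInterior_subset hF).2,
    trace_choi_of_tracePreserving hE.2, sub_self]

theorem exists_channel_split (hF : F ∈ intrinsicInterior ℝ (channels (Fin 2)))
    {E : MatrixMap (Fin 2)} (hE : E ∈ channels (Fin 2)) :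
    ∃ G ∈ channels (Fin 2), F = (2 / lambda1 (magicSymm (choi F)⁻¹)) • E +
      (1 - 2 / lambda1 (magicSymm (choi F)⁻¹)) • G :=
  ⟨_, exists_channel_of_sub_posSemidef (intrinsicInterior_subset hF) hE
    (two_div_lambda1_lt_one hF) (choi_sub_posSemidef hF hE)⟩

/-- The channel that complements a leading unitary channel has `J⁻¹|U⟩⟩` in the kernel of its Choi
operator. -/
theorem IsLeadingUnitEigenvector.exists_split
    (hF : F ∈ intrinsicInterior ℝ (channels (Fin 2))) {v : Fin 4 → ℝ}
    (hv : IsLeadingUnitEigenvector (magicSymm (choi F)⁻¹) v) :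
    ∃ G ∈ channels (Fin 2), F = (2 / lambda1 (magicSymm (choi F)⁻¹)) • conjMap (magicUnitary v) +
      (1 - 2 / lambda1 (magicSymm (choi F)⁻¹)) • G ∧
      choi G *ᵥ ((choi F)⁻¹ *ᵥ magicVector v) = 0 := by
  have hJ := choi_posDef hF
  have hl := lambda1_magicSymm_pos hJ.inv
  obtain ⟨G, hG, h⟩ := exists_channel_split hF (conjMap_mem_channels (magicUnitary_mem hv.1))
  refine ⟨G, hG, h, ?_⟩
  have hb : 1 - 2 / lambda1 (magicSymm (choi F)⁻¹) ≠ 0 := by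
    have := two_div_lambda1_lt_one hF; linarith
  have h2 := congrArg (fun Φ => choi Φ *ᵥ ((choi F)⁻¹ *ᵥ magicVector v)) h
  simp only [choi_add, choi_smul, Matrix.add_mulVec, Matrix.smul_mulVec] at h2
  rw [Matrix.mulVec_mulVec, Matrix.mul_nonsing_inv _ ((Matrix.isUnit_iff_isUnit_det _).1 hJ.isUnit),
    Matrix.one_mulVec, choi_conjMap_mulVec, vectorize_magicUnitary,
    hv.dotProduct_magicVector hJ.inv.1] at h2
  -- The unitary part alone already sends `J⁻¹|U⟩⟩` to `|U⟩⟩`, as `J_F` does, so nothing is left for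
  -- `G`.
  have h3 : (2 / lambda1 (magicSymm (choi F)⁻¹)) •
      ((2 : ℂ)⁻¹ * (lambda1 (magicSymm (choi F)⁻¹) : ℂ)) • magicVector v = magicVector v := by
    rw [← Complex.coe_smul, smul_smul]
    push_cast
    have : (lambda1 (magicSymm (choi F)⁻¹) : ℂ) ≠ 0 := by exact_mod_cast hl.ne'
    rw [show (2 / (lambda1 (magicSymm (choi F)⁻¹) : ℂ)) *
      (2⁻¹ * (lambda1 (magicSymm (choi F)⁻¹) : ℂ)) = 1 by field_simp, one_smul]
  rw [h3, left_eq_add] at h2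
  exact (smul_eq_zero.1 h2).resolve_left hb

theorem inv_mulVec_magicVector_ne_zero (hJ : (choi F).PosDef) {v : Fin 4 → ℝ} (hv : v ⬝ᵥ v = 1) :
    (choi F)⁻¹ *ᵥ magicVector v ≠ 0 := by
  intro h
  simpa [h] using hJ.inv.dotProduct_mulVec_pos (magicVector_ne_zero hv)

theorem boundariness_channels (hF : F ∈ intrinsicInterior ℝ (channels (Fin 2))) :
    boundariness (channels (Fin 2)) F = 2 / lambda1 (magicSymm (choi F)⁻¹) := by
  have hJ := choi_posDef hF
  obtain ⟨v, hv⟩ := exists_isLeadingUnitEigenvector (isHermitian_magicSymm (K := (choi F)⁻¹))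
  obtain ⟨G, hG, h, hker⟩ := hv.exists_split hF
  exact boundariness_eq_of_split convex_channels hF
    (div_pos two_pos (lambda1_magicSymm_pos hJ.inv)) (two_div_lambda1_lt_one hF).le
    (fun E hE => exists_channel_split hF hE) (conjMap_mem_boundary (magicUnitary_mem hv.1))
    (mem_boundary_of_choi_mulVec_eq_zero hG (inv_mulVec_magicVector_ne_zero hJ hv.1) hker) h

/-- The real functional `Φ ↦ Re (tr J_Φ - a ⟨x|J_Φ|x⟩)`. -/
def choiFunctional (a : ℝ) (x : Fin 2 × Fin 2 → ℂ) : MatrixMap (Fin 2) →ₗ[ℝ] ℝ where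
  toFun Φ := (choi Φ).trace.re - a * (star x ⬝ᵥ choi Φ *ᵥ x).re
  map_add' Φ Ψ := by
    rw [choi_add, Matrix.trace_add, Matrix.add_mulVec, dotProduct_add, Complex.add_re,
      Complex.add_re]
    ring
  map_smul' r Φ := by
    rw [choi_smul, Matrix.trace_smul, Matrix.smul_mulVec, dotProduct_smul, Complex.smul_re,
      Complex.smul_re]
    simp only [smul_eq_mul, RingHom.id_apply]
    ring

theorem choiFunctional_apply_of_mem {E : MatrixMap (Fin 2)} (hE : E ∈ channels (Fin 2)) (a : ℝ)
    (x : Fin 2 × Fin 2 → ℂ) :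
    choiFunctional a x E = 1 - a * (star x ⬝ᵥ choi E *ᵥ x).re := by
  change (choi E).trace.re - a * (star x ⬝ᵥ choi E *ᵥ x).re = _
  rw [trace_choi_of_tracePreserving hE.2, Complex.one_re]

theorem IsLeadingUnitEigenvector.baseNorm_eq
    (hF : F ∈ intrinsicInterior ℝ (channels (Fin 2))) {v : Fin 4 → ℝ}
    (hv : IsLeadingUnitEigenvector (magicSymm (choi F)⁻¹) v) :
    baseNorm (channels (Fin 2)) (F - conjMap (magicUnitary v)) =
      2 * (1 - 2 / lambda1 (magicSymm (choi F)⁻¹)) := by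
  have hJ := choi_posDef hF
  have hl := lambda1_magicSymm_pos hJ.inv
  have hb1 := two_div_lambda1_lt_one hF
  have hb0 := div_pos two_pos hl
  obtain ⟨G, hG, h, hker⟩ := hv.exists_split hF
  have hU := conjMap_mem_channels (magicUnitary_mem hv.1)
  have hval := hv.dotProduct_magicVector hJ.inv.1
  have hsub (E : MatrixMap (Fin 2)) (hE : E ∈ channels (Fin 2)) := choi_sub_posSemidef hF hE
  have hbl : 2 / lambda1 (magicSymm (choi F)⁻¹) * lambda1 (magicSymm (choi F)⁻¹) = 2 :=
    div_mul_cancel₀ _ hl.ne'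
  have hqF : star ((choi F)⁻¹ *ᵥ magicVector v) ⬝ᵥ choi F *ᵥ ((choi F)⁻¹ *ᵥ magicVector v) =
      (lambda1 (magicSymm (choi F)⁻¹) : ℂ) := by
    rw [hJ.star_inv_mulVec_dotProduct, hval]
  generalize lambda1 (magicSymm (choi F)⁻¹) = l at *
  set b := 2 / l
  -- With `x = J⁻¹|U⟩⟩` one has `⟨x|J_F|x⟩ = l`, hence `0 ≤ b² ⟨x|J_E|x⟩ ≤ b l = 2` for every
  -- channel `E`. The upper end is reached at `U` and the lower end at `G`, so the coefficient `b²`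
  -- gives the values `-1` and `1`.
  refine baseNorm_sub_eq hU hG hb1.le h
    (f := choiFunctional (b ^ 2) ((choi F)⁻¹ *ᵥ magicVector v)) ?_ ?_ ?_
  · intro E hE
    rw [choiFunctional_apply_of_mem hE]
    have h1 := hE.1.choi_posSemidef.re_dotProduct_nonneg ((choi F)⁻¹ *ᵥ magicVector v)
    have h2 := (hsub E hE).re_dotProduct_nonneg ((choi F)⁻¹ *ᵥ magicVector v)
    rw [Matrix.sub_mulVec, Matrix.smul_mulVec, dotProduct_sub, dotProduct_smul, hqF] at h2
    simp only [RCLike.re_to_complex, Complex.sub_re, Complex.ofReal_re, Complex.smul_re,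
      smul_eq_mul] at h1 h2
    rw [abs_le]
    constructor <;> nlinarith [mul_nonneg (sq_nonneg b) h1, mul_nonneg hb0.le h2]
  · rw [choiFunctional_apply_of_mem hU, re_dotProduct_choi_conjMap, vectorize_magicUnitary, hval,
      Complex.norm_real, Real.norm_eq_abs, sq_abs]
    linear_combination (-1 / 2 * (b * l) - 1) * hbl
  · rw [choiFunctional_apply_of_mem hG, hker]
    simp

theorem IsLeadingUnitEigenvector.of_baseNorm_eq
    (hF : F ∈ intrinsicInterior ℝ (channels (Fin 2))) {U : Matrix (Fin 2) (Fin 2) ℂ}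
    (hU : U ∈ Matrix.unitaryGroup (Fin 2) ℂ)
    (h : baseNorm (channels (Fin 2)) (F - conjMap U) =
      2 * (1 - 2 / lambda1 (magicSymm (choi F)⁻¹))) :
    ∃ (c : ℂ) (v : Fin 4 → ℝ), ‖c‖ = 1 ∧ IsLeadingUnitEigenvector (magicSymm (choi F)⁻¹) v ∧
      vectorize U = c • magicVector v := by
  have hJ := choi_posDef hF
  have hl := lambda1_magicSymm_pos hJ.inv
  have hb1 := two_div_lambda1_lt_one hF
  obtain ⟨c, v, hc, hv, hUv, hq⟩ := exists_dotProduct_vectorize hJ.inv.1 hU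
  refine ⟨c, v, hc, isLeadingUnitEigenvector_of_le isHermitian_magicSymm hv ?_, hUv⟩
  by_contra! hlt
  set q := v ⬝ᵥ magicSymm (choi F)⁻¹ *ᵥ v
  have hq0 : 0 < q := by
    have h1 := hJ.inv.dotProduct_mulVec_pos (magicVector_ne_zero hv)
    rw [QuantumChannel.dotProduct_magicVector hJ.inv.1] at h1
    exact_mod_cast h1
  -- If `q < l` there is room for a weight `s` above `2 / l` but below `2 / q`, which still splits
  -- off from `F`; `s < 1` allows normalizing the remainder. The distance is then at most `2 (1 -
  -- s)`, contradicting the assumed equality.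
  obtain ⟨s, hs, hs2⟩ := exists_between
    (lt_min hb1 (div_lt_div_of_pos_left two_pos hq0 hlt))
  obtain ⟨hs1, hsq⟩ := lt_min_iff.1 hs2
  have hs0 : 0 < s := (div_pos two_pos hl).trans hs
  have hpsd : (choi F - s • choi (conjMap U)).PosSemidef := by
    have hUc := conjMap_mem_channels hU
    refine posSemidef_of_re (hJ.1.sub (hUc.1.choi_posSemidef.1.smul (IsSelfAdjoint.all _)))
      fun x => ?_
    have h1 := hJ.norm_sq_dotProduct_le_inv (vectorize U) x
    rw [hq, Complex.ofReal_re] at h1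
    have h2 := hJ.posSemidef.re_dotProduct_nonneg x
    rw [RCLike.re_to_complex] at h2
    rw [Matrix.sub_mulVec, Matrix.smul_mulVec, dotProduct_sub, dotProduct_smul, Complex.sub_re,
      Complex.smul_re, re_dotProduct_choi_conjMap, smul_eq_mul]
    rw [lt_div_iff₀ hq0] at hsq
    nlinarith [mul_le_mul_of_nonneg_left h1 hs0.le, mul_le_mul_of_nonneg_right hsq.le h2]
  obtain ⟨hG, hsplit⟩ := exists_channel_of_sub_posSemidef (intrinsicInterior_subset hF)
    (conjMap_mem_channels hU) hs1 hpsd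
  have := baseNorm_sub_le (conjMap_mem_channels hU) hG hs1.le hsplit
  linarith

end Main

end QuantumChannel

end

theorem mainTheorem8 (F : MatrixMap (Fin 2))
    (hF : F ∈ intrinsicInterior ℝ (channels (Fin 2))) :
    -- `W` is unitary and `J_F` is invertible
    magicWᴴ * magicW = 1 ∧ magicW * magicWᴴ = 1 ∧ IsUnit (choi F).det ∧
    -- the matrix `W† J_F⁻¹ W + (W† J_F⁻¹ W)ᵀ` is a real symmetric matrix `R`
    ∃ R : Matrix (Fin 4) (Fin 4) ℝ,
      R.map (fun r : ℝ => (r : ℂ)) =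
        magicWᴴ * (choi F)⁻¹ * magicW + (magicWᴴ * (choi F)⁻¹ * magicW)ᵀ ∧
      R.IsSymm ∧
      -- its largest eigenvalue exists, is positive, and gives the boundariness
      IsGreatest (realEigenvalues R) (lambda1 R) ∧ 0 < lambda1 R ∧
      boundariness (channels (Fin 2)) F = 2 / lambda1 R ∧
      -- `2 (1 - b(F))` bounds the base norm distance of `F` from every channel
      (∀ E ∈ channels (Fin 2),
        baseNorm (channels (Fin 2)) (F - E) ≤ 2 * (1 - boundariness (channels (Fin 2)) F)) ∧
      -- every leading eigenvector `v` yields a unitary channel at that distance, `|U⟩⟩ = √2 W v`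
      (∀ v : Fin 4 → ℝ, IsLeadingUnitEigenvector R v →
        ∃ U ∈ Matrix.unitaryGroup (Fin 2) ℂ, vectorize U = magicVector v ∧
          conjMap U ∈ channels (Fin 2) ∧
          baseNorm (channels (Fin 2)) (F - conjMap U) =
            2 * (1 - boundariness (channels (Fin 2)) F)) ∧
      -- and every unitary channel at that distance arises so (a global phase is immaterial)
      (∀ U ∈ Matrix.unitaryGroup (Fin 2) ℂ,
        baseNorm (channels (Fin 2)) (F - conjMap U) =
            2 * (1 - boundariness (channels (Fin 2)) F) →
        ∃ (c : ℂ) (v : Fin 4 → ℝ), ‖c‖ = 1 ∧ IsLeadingUnitEigenvector R v ∧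
          vectorize U = c • magicVector v) := by
  have hJ := choi_posDef hF
  refine ⟨conjTranspose_magicW_mul_self, magicW_mul_conjTranspose_self,
    (Matrix.isUnit_iff_isUnit_det _).1 hJ.isUnit, magicSymm (choi F)⁻¹, magicSymm_map hJ.inv.1,
    isSymm_magicSymm, isGreatest_lambda1 isHermitian_magicSymm, lambda1_magicSymm_pos hJ.inv,
    boundariness_channels hF, ?_⟩
  rw [boundariness_channels hF]
  refine ⟨fun E hE => ?_, fun v hv => ?_, fun U hU h => ?_⟩
  · obtain ⟨G, hG, h⟩ := exists_channel_split hF hE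
    exact baseNorm_sub_le hE hG (two_div_lambda1_lt_one hF).le h
  · exact ⟨magicUnitary v, magicUnitary_mem hv.1, vectorize_magicUnitary v,
      conjMap_mem_channels (magicUnitary_mem hv.1), hv.baseNorm_eq hF⟩
  · exact IsLeadingUnitEigenvector.of_baseNorm_eq hF hU h
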